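/- **Setting.** Let $G=(V,E)$ be a finite acyclic directed graph (parallel channels allowed, every channel of unit capacity) with one source node $s$, a set $T\subseteq V\setminus\{s\}$ of sink nodes, and the set $J=V\setminus(\{s\}\cup T)$ of internal nodes; $s$ has no incoming channels and sinks have no outgoing channels. For $t\in T$ let $C_t$ be the minimum cut capacity between $s$ and $t$. Let $w$ be an information rate with $w\le C_t$ for all $t\in T$, and put $\delta_t=C_t-w$. Let $\mathcal F$ be a finite field. Let $In(s)=\{d_1',\dots,d_w'\}$ consist of $w$ imaginary message channels, and for $v\ne s$ let $In(v)$ be the set of channels with head $v$. A linear network code over $\mathcal F$ is a choice of local encoding coefficients $k_{d,e}\in\mathcal F$ for all $e\in E$ and $d\in In(tail(e))$. Its extended global encoding kernels are the vectors $\tilde f_d$, with entries indexed by $In(s)\cup E$, given by $\tilde f_{d_i'}=1_{d_i'}$ and $$\tilde f_e=\sum_{d\in In(tail(e))}k_{d,e}\tilde f_d+1_e\qquad(e\in E),$$ where $1_d$ is the indicator vector of $d$. For $t\in T$ let $\tilde F_t$ be the matrix with columns $\tilde f_e$, $e\in In(t)$. The message space is $\Phi(t)=\{(X,0)\tilde F_t: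 X\in\mathcal F^w\}$, and the error space of an error pattern $\rho\subseteq E$ is $\Delta(t,\rho)=\{(0,Z)\tilde F_t: Z\in\mathcal F^E,\ Z_e=0\text{ for }e\notin\rho\}$. Write $\rho\prec_t\rho'$ if $\Delta(t,\rho)\subseteq\Delta(t,\rho')$ for every linear network code over $\mathcal F$; let $rank_t(\rho)=\min\{|\rho'|:\rho\prec_t\rho'\}$ and $R_t(\delta_t)=\{\rho\subseteq E: |\rho|=rank_t(\rho)=\delta_t\}$. A code is regular if $\dim\Phi(t)=w$ for all $t\in T$, and $d_{\min}^{(t)}=\min\{rank_t(\rho):\dim(\Delta(t,\rho)\cap\Phi(t))>0\}$ (with $\min\emptyset=\infty$). **Theorem.** Choose all local encoding coefficients independently and uniformly at random from $\mathcal F$. 1. For each $t\in T$, if $|R_t(\delta_t)|\le|\mathcal F|-1$ or $|J|$ is even, then $$\Pr\big(\dim\Phi(t)<w\ \text{ or }\ d_{\min}^{(t)}<\delta_t+1\big)<1-\Big(1-\frac{|R_t(\delta_t)|}{|\mathcal F|-1}\Big)^{|J|+1}.$$ 2. If $T\neq\emptyset$, and $\sum_{t\in T}|R_t(\delta_t)|\le|\mathcal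 F|-1$ or $|J|$ is even, then $$\Pr\big(\text{the code is not regular, or } d_{\min}^{(t)}<\delta_t+1\text{ for some }t\in T\big)<1-\Big(1-\frac{\sum_{t\in T}|R_t(\delta_t)|}{|\mathcal F|-1}\Big)^{|J|+1}.$$ -/

import Mathlib

open MeasureTheory ProbabilityTheory

/-- A finite acyclic single source multicast network with unit capacity channels. `V` is the set of
nodes, `E` the set of channels (parallel channels are allowed); a channel `e` leads from `tail e`
to `head e`. -/
structure MulticastNetwork (V E : Type*) where
  tail : E → V
  head : E → V
  source : V
  sinks : Finset V
  acyclic : ∀ v, ¬ Relation.TransGen (fun a b => ∃ e, tail e = a ∧ head e = b) v v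
  source_notMem_sinks : source ∉ sinks
  head_ne_source : ∀ e, head e ≠ source
  tail_notMem_sinks : ∀ e, tail e ∉ sinks

namespace MulticastNetwork

/-- The internal nodes: neither the source nor a sink. -/
def internalNodes {V E : Type*} [Fintype V] [DecidableEq V] (N : MulticastNetwork V E) :
    Finset V :=
  Finset.univ \ insert N.source N.sinks

/-- A set of channels is a cut between the source and `t` if there is no path from the source to
`t` after its removal. -/
def IsCut {V E : Type*} (N : MulticastNetwork V E) (t : V) (C : Finset E) : Prop :=
  ¬ Relation.ReflTransGen (fun a b => ∃ e, e ∉ C ∧ N.tail e = a ∧ N.head e = b) N.source t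

/-- The minimum cut capacity `C_t` between the source and `t`. -/
noncomputable def minCut {V E : Type*} (N : MulticastNetwork V E) (t : V) : ℕ :=
  sInf {n | ∃ C : Finset E, N.IsCut t C ∧ C.card = n}

/-- The redundancy `δ_t = C_t - w` (used for `w ≤ C_t`). -/
noncomputable def redundancy {V E : Type*} (N : MulticastNetwork V E) (w : ℕ) (t : V) : ℕ :=
  N.minCut t - w

/-- The head of a channel, where `Sum.inl i` is the `i`-th imaginary message channel, which enters
the source, and `Sum.inr e` is the channel `e` of the network. So `In(v)` is
`{d | N.chanHead d = v}`; for the source it consists of the imaginary message channels only. -/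
def chanHead {V E : Type*} (N : MulticastNetwork V E) {w : ℕ} : Fin w ⊕ E → V
  | Sum.inl _ => N.source
  | Sum.inr e => N.head e

/-- The adjacent pairs of channels `(d, e)`, i.e. `d ∈ In(tail e)`. -/
abbrev AdjPair {V E : Type*} (N : MulticastNetwork V E) (w : ℕ) : Type _ :=
  {p : (Fin w ⊕ E) × E // N.chanHead p.1 = N.tail p.2}

/-- A linear network code of rate `w` over `F`: a local encoding coefficient `k_{d,e}` for each
adjacent pair of channels. -/
abbrev Code {V E : Type*} (N : MulticastNetwork V E) (w : ℕ) (F : Type*) : Type _ :=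
  N.AdjPair w → F

theorem wellFounded_adj {V E : Type*} [Finite V] (N : MulticastNetwork V E) :
    WellFounded (fun d e : E => N.head d = N.tail e) := by
  have hV : WellFounded
      (Relation.TransGen (fun a b => ∃ e, N.tail e = a ∧ N.head e = b)) := by
    have : IsTrans V (Relation.TransGen (fun a b => ∃ e, N.tail e = a ∧ N.head e = b)) :=
      ⟨fun _ _ _ h₁ h₂ => h₁.trans h₂⟩
    have : Std.Irrefl (Relation.TransGen (fun a b => ∃ e, N.tail e = a ∧ N.head e = b)) :=
      ⟨N.acyclic⟩
    exact Finite.wellFounded_of_trans_of_irrefl _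
  refine Subrelation.wf ?_ (InvImage.wf N.tail hV)
  intro d e h
  exact Relation.TransGen.single ⟨d, rfl, h⟩

/-- The extended global encoding kernels of the channels of the network, by recursion along the
network; see `extKernel_inr` for the recursive formula. -/
noncomputable def edgeKernel {V E F : Type*} [Fintype V] [DecidableEq V] [Fintype E]
    [DecidableEq E] [Field F] (N : MulticastNetwork V E) {w : ℕ} (k : N.Code w F) :
    E → (Fin w ⊕ E → F) :=
  N.wellFounded_adj.fix fun e ih =>
    (∑ d : {d : Fin w ⊕ E // N.chanHead d = N.tail e},
      k ⟨(d.1, e), d.2⟩ • (match d with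
        | ⟨Sum.inl i, _⟩ => Pi.single (Sum.inl i) 1
        | ⟨Sum.inr c, h⟩ => ih c h)) + Pi.single (Sum.inr e) 1

/-- The extended global encoding kernels `f̃_d`, for `d` an imaginary message channel or a channel
of the network; the entries are indexed by `In(s) ∪ E`. -/
noncomputable def extKernel {V E F : Type*} [Fintype V] [DecidableEq V] [Fintype E]
    [DecidableEq E] [Field F] (N : MulticastNetwork V E) {w : ℕ} (k : N.Code w F) :
    Fin w ⊕ E → (Fin w ⊕ E → F)
  | Sum.inl i => Pi.single (Sum.inl i) 1
  | Sum.inr e => N.edgeKernel k e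

/-- `f̃_e = ∑_{d ∈ In(tail e)} k_{d,e} f̃_d + 1_e`. -/
theorem extKernel_inr {V E F : Type*} [Fintype V] [DecidableEq V] [Fintype E]
    [DecidableEq E] [Field F] (N : MulticastNetwork V E) {w : ℕ} (k : N.Code w F) (e : E) :
    N.extKernel k (Sum.inr e) =
      (∑ d : {d : Fin w ⊕ E // N.chanHead d = N.tail e},
        k ⟨(d.1, e), d.2⟩ • N.extKernel k d.1) + Pi.single (Sum.inr e) 1 := by
  change N.edgeKernel k e = _
  unfold edgeKernel
  rw [WellFounded.fix_eq]
  congr 1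
  refine Finset.sum_congr rfl fun d _ => ?_
  rcases d with ⟨i | c, h⟩ <;> rfl

/-- The decoding matrix `F̃_t = (f̃_e : e ∈ In(t))`. -/
noncomputable def decodingMatrix {V E F : Type*} [Fintype V] [DecidableEq V] [Fintype E]
    [DecidableEq E] [Field F] (N : MulticastNetwork V E) {w : ℕ} (k : N.Code w F) (t : V) :
    Matrix (Fin w ⊕ E) {e : E // N.head e = t} F :=
  Matrix.of fun x e => N.extKernel k (Sum.inr e.1) x

/-- The row vectors indexed by `ι` that vanish outside `S`. -/
def vectorsOn {ι : Type*} (F : Type*) [Field F] (S : Set ι) : Submodule F (ι → F) where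
  carrier := {y | ∀ i, i ∉ S → y i = 0}
  add_mem' := fun ha hb i hi => by simp [ha i hi, hb i hi]
  zero_mem' := fun _ _ => rfl
  smul_mem' := fun c x hx i hi => by simp [hx i hi]

/-- The message space `Φ(t) = {(X, 0) F̃_t : X ∈ F^w}`. -/
noncomputable def messageSpace {V E F : Type*} [Fintype V] [DecidableEq V] [Fintype E]
    [DecidableEq E] [Field F] (N : MulticastNetwork V E) {w : ℕ} (k : N.Code w F) (t : V) :
    Submodule F ({e : E // N.head e = t} → F) :=
  (vectorsOn F (Set.range (Sum.inl : Fin w → Fin w ⊕ E))).map (N.decodingMatrix k t).vecMulLinear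

/-- The error space `Δ(t, ρ) = {(0, Z) F̃_t : Z matches ρ}` of an error pattern `ρ`. -/
noncomputable def errorSpace {V E F : Type*} [Fintype V] [DecidableEq V] [Fintype E]
    [DecidableEq E] [Field F] (N : MulticastNetwork V E) {w : ℕ} (k : N.Code w F) (t : V)
    (ρ : Finset E) : Submodule F ({e : E // N.head e = t} → F) :=
  (vectorsOn F ((Sum.inr : E → Fin w ⊕ E) '' (ρ : Set E))).map
    (N.decodingMatrix k t).vecMulLinear

/-- `ρ₁` is dominated by `ρ₂` with respect to `t`: `Δ(t, ρ₁) ⊆ Δ(t, ρ₂)` for every linear network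
code of rate `w` over `F`. -/
def Dominated {V E : Type*} [Fintype V] [DecidableEq V] [Fintype E] [DecidableEq E]
    (N : MulticastNetwork V E) (w : ℕ) (F : Type*) [Field F] (t : V) (ρ₁ ρ₂ : Finset E) : Prop :=
  ∀ k : N.Code w F, N.errorSpace k t ρ₁ ≤ N.errorSpace k t ρ₂

/-- `rank_t(ρ)`, the least cardinality of an error pattern which dominates `ρ`. -/
noncomputable def patternRank {V E : Type*} [Fintype V] [DecidableEq V] [Fintype E]
    [DecidableEq E] (N : MulticastNetwork V E) (w : ℕ) (F : Type*) [Field F] (t : V)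
    (ρ : Finset E) : ℕ :=
  sInf {n | ∃ ρ' : Finset E, N.Dominated w F t ρ ρ' ∧ ρ'.card = n}

open Classical in
/-- `R_t(δ_t)`, the set of error patterns `ρ` with `|ρ| = rank_t(ρ) = δ_t`. -/
noncomputable def fullRankPatterns {V E : Type*} [Fintype V] [DecidableEq V] [Fintype E]
    [DecidableEq E] (N : MulticastNetwork V E) (w : ℕ) (F : Type*) [Field F] (t : V) :
    Finset (Finset E) :=
  Finset.univ.filter fun ρ =>
    ρ.card = N.redundancy w t ∧ N.patternRank w F t ρ = N.redundancy w t

/-- A code is regular if `dim Φ(t) = w` for every sink `t`. -/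
def IsRegular {V E F : Type*} [Fintype V] [DecidableEq V] [Fintype E]
    [DecidableEq E] [Field F] (N : MulticastNetwork V E) {w : ℕ} (k : N.Code w F) : Prop :=
  ∀ t ∈ N.sinks, Module.finrank F (N.messageSpace k t) = w

/-- The minimum distance `d_min^(t) = min {rank_t(ρ) : dim (Δ(t, ρ) ∩ Φ(t)) > 0}` (which is `⊤`
only if there is no such `ρ`). -/
noncomputable def minDist {V E F : Type*} [Fintype V] [DecidableEq V] [Fintype E]
    [DecidableEq E] [Field F] (N : MulticastNetwork V E) {w : ℕ} (k : N.Code w F) (t : V) : ℕ∞ :=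
  ⨅ ρ : Finset E, ⨅ _ : 0 < Module.finrank F (N.errorSpace k t ρ ⊓ N.messageSpace k t :
    Submodule F ({e : E // N.head e = t} → F)), (N.patternRank w F t ρ : ℕ∞)

/-- The law of the random linear network code: the local encoding coefficients are independent and
uniformly distributed on `F`. -/
noncomputable def randomCode {V E : Type*} [DecidableEq V] [Fintype E]
    (N : MulticastNetwork V E) (w : ℕ) (F : Type*) [Fintype F] [MeasurableSpace F] :
    Measure (N.Code w F) :=
  Measure.pi fun _ : N.AdjPair w => uniformOn (Set.univ : Set F)

/-- `P_ec(t)`, the failure probability of random linear network error correction MDS coding for the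
sink `t`. -/
noncomputable def failureProbAt {V E : Type*} [Fintype V] [DecidableEq V] [Fintype E]
    [DecidableEq E] (N : MulticastNetwork V E) (w : ℕ) (F : Type*) [Field F] [Fintype F]
    [MeasurableSpace F] (t : V) : ℝ :=
  (N.randomCode w F).real {k | Module.finrank F (N.messageSpace k t) < w ∨
    N.minDist k t < ((N.redundancy w t + 1 : ℕ) : ℕ∞)}

/-- `P_ec`, the failure probability of random linear network error correction MDS coding for the
whole network. -/
noncomputable def failureProb {V E : Type*} [Fintype V] [DecidableEq V] [Fintype E]
    [DecidableEq E] (N : MulticastNetwork V E) (w : ℕ) (F : Type*) [Field F] [Fintype F]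
    [MeasurableSpace F] : ℝ :=
  (N.randomCode w F).real {k | ¬ N.IsRegular k ∨
    ∃ t ∈ N.sinks, N.minDist k t < ((N.redundancy w t + 1 : ℕ) : ℕ∞)}

end MulticastNetwork

set_option linter.unusedSectionVars false

/-! Fix a sink t and ρ in R_t(δ_t), and let A consist of the message channels and ρ. Fewer than C_t
= w + δ_t channels cannot separate A from In(t), so Menger's theorem gives |A| = w + δ_t disjoint
paths into In(t) (`exists_linking_withMessages`). Process the non-sink nodes in topological order
and follow the frontier, the last processed channels on these paths. The invariant `FullRank` says
that the kernels of the frontier, restricted to A, span F^A. It is trivial at the start; at the end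
the frontier lies in In(t), and the invariant says that the rows of F̃_t indexed by A are
independent.

The heart is `card_not_fullRank_insert_lt`: given the invariant so far, one node destroys it with
probability less than 1/(q - 1), where q = |F|. A union bound over the patterns at each of the |J| +
1 non-sink nodes, followed by multiplication, gives the estimate (`card_fullRankCodes`).

Independence for all ρ in R_t(δ_t) gives dim Φ(t) = w, and also the distance: a pattern of rank at
most δ_t is dominated by one whose size is its rank, and that one extends to a member of R_t(δ_t)
(`exists_superset_mem_fullRankPatterns`). If there are more than q - 1 patterns, then evenness of
|J| makes the power negative and the bound exceeds 1. -/

namespace MulticastNetwork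

/-! ### Kernels as an inverse matrix; message and error spaces as row spans. -/

section Kernels

variable {V E F : Type*} [Fintype V] [DecidableEq V] [Fintype E] [DecidableEq E] [Field F]
  (N : MulticastNetwork V E) {w : ℕ}

/-- The local encoding coefficient `k_{d,e}`, extended by `0` to all pairs of channels. -/
def coef (k : N.Code w F) (d : Fin w ⊕ E) (e : E) : F :=
  if h : N.chanHead d = N.tail e then k ⟨(d, e), h⟩ else 0

theorem coef_eq_zero (k : N.Code w F) {d : Fin w ⊕ E} {e : E} (h : N.chanHead d ≠ N.tail e) :
    N.coef k d e = 0 := dif_neg h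

theorem extKernel_inr_coef (k : N.Code w F) (e : E) :
    N.extKernel k (Sum.inr e) =
      (∑ d, N.coef k d e • N.extKernel k d) + Pi.single (Sum.inr e) 1 := by
  rw [extKernel_inr]
  congr 1
  have h1 : ∀ d : {d : Fin w ⊕ E // N.chanHead d = N.tail e},
      k ⟨(d.1, e), d.2⟩ • N.extKernel k d.1 = N.coef k d.1 e • N.extKernel k d.1 := by
    intro d
    rw [coef, dif_pos d.2]
  rw [Finset.sum_congr rfl fun d _ => h1 d,
    ← Finset.sum_subtype (Finset.univ.filter fun d => N.chanHead d = N.tail e) (by simp)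
      (fun d => N.coef k d e • N.extKernel k d)]
  exact Finset.sum_subset (Finset.filter_subset _ _) fun d _ hd => by
    rw [coef_eq_zero N k (by simpa using hd), zero_smul]

/-- The matrix with columns `f̃_d`, `d ∈ In(s) ∪ E`. -/
noncomputable def kernelMatrix (k : N.Code w F) : Matrix (Fin w ⊕ E) (Fin w ⊕ E) F :=
  Matrix.of fun x d => N.extKernel k d x

/-- The matrix of the local encoding coefficients. -/
def coefMatrix (k : N.Code w F) : Matrix (Fin w ⊕ E) (Fin w ⊕ E) F :=
  Matrix.of fun d => Sum.elim (fun _ => 0) (N.coef k d)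

theorem kernelMatrix_mul (k : N.Code w F) :
    N.kernelMatrix k * (1 - N.coefMatrix k) = 1 := by
  rw [mul_sub, mul_one, sub_eq_iff_eq_add]
  ext x d
  rcases d with i | e
  · simp [kernelMatrix, coefMatrix, Matrix.mul_apply, extKernel, Matrix.one_apply, Pi.single_apply]
  · simp only [kernelMatrix, coefMatrix, Matrix.mul_apply, Matrix.one_apply, Matrix.add_apply,
      Matrix.of_apply, Sum.elim_inr]
    rw [extKernel_inr_coef, Pi.add_apply, Finset.sum_apply, add_comm]
    congr 1
    · simp [Pi.single_apply]
    · exact Finset.sum_congr rfl fun d _ => by simp [mul_comm]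

/-- The recursion for the rows of the matrix of the extended global encoding kernels. -/
theorem extKernel_apply (k : N.Code w F) (x d : Fin w ⊕ E) :
    N.extKernel k d x = (if x = d then 1 else 0) +
      ∑ e, N.coef k x e * N.extKernel k d (Sum.inr e) := by
  -- The defining recursion is K(1 - M) = 1; commuting the two inverse factors turns it into a
  -- recursion along rows.
  have h := mul_eq_one_comm.mp (N.kernelMatrix_mul k)
  rw [sub_mul, one_mul, sub_eq_iff_eq_add] at h
  have := congrFun (congrFun h x) d
  simpa [kernelMatrix, coefMatrix, Matrix.mul_apply, Matrix.one_apply] using this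

/-- The row of the decoding matrix `F̃_t` which belongs to the channel `x`. -/
noncomputable def decodingRow (k : N.Code w F) (t : V) (x : Fin w ⊕ E) :
    {e : E // N.head e = t} → F :=
  N.decodingMatrix k t x

theorem decodingRow_apply (k : N.Code w F) (t : V) (x : Fin w ⊕ E) (e : {e : E // N.head e = t}) :
    N.decodingRow k t x e = N.extKernel k (Sum.inr e.1) x := rfl

theorem decodingRow_eq (k : N.Code w F) (t : V) (x : Fin w ⊕ E) (hx : ∀ e, x = Sum.inr e →
    N.head e ≠ t) :
    N.decodingRow k t x = ∑ e, N.coef k x e • N.decodingRow k t (Sum.inr e) := by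
  funext e
  rw [decodingRow_apply, extKernel_apply, if_neg (fun h => hx _ h e.2), zero_add]
  simp [decodingRow_apply]

/-- A sink has no outgoing channels, so the sum in the row recursion is empty. -/
theorem decodingRow_of_head_eq (k : N.Code w F) {t : V} (ht : t ∈ N.sinks)
    (e : {e : E // N.head e = t}) :
    N.decodingRow k t (Sum.inr e.1) = Pi.single e 1 := by
  funext e'
  rw [decodingRow_apply, extKernel_apply, Finset.sum_eq_zero, add_zero]
  · simp [Pi.single_apply, Subtype.ext_iff, eq_comm]
  · intro e'' _
    rw [coef_eq_zero, zero_mul]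
    intro h
    exact N.tail_notMem_sinks e'' (by rw [← h]; simpa [chanHead, e.2] using ht)

theorem vectorsOn_eq_span {ι : Type*} [Fintype ι] [DecidableEq ι] (S : Set ι) :
    vectorsOn F S = Submodule.span F ((fun i => Pi.single i (1 : F)) '' S) := by
  apply le_antisymm
  · intro y hy
    rw [pi_eq_sum_univ' y]
    refine Submodule.sum_mem _ fun i _ => ?_
    by_cases hi : i ∈ S
    · refine Submodule.smul_mem _ _ (Submodule.subset_span ⟨i, hi, ?_⟩)
      funext j; simp [Pi.single_apply, eq_comm]
    · rw [hy i hi, zero_smul]; exact Submodule.zero_mem _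
  · rw [Submodule.span_le]
    rintro _ ⟨i, hi, rfl⟩ j hj
    exact Pi.single_eq_of_ne (by rintro rfl; exact hj hi) _

theorem map_vectorsOn (k : N.Code w F) (t : V) (S : Set (Fin w ⊕ E)) :
    (vectorsOn F S).map (N.decodingMatrix k t).vecMulLinear =
      Submodule.span F (N.decodingRow k t '' S) := by
  rw [vectorsOn_eq_span, Submodule.map_span, Set.image_image]
  congr 1
  refine Set.image_congr fun x _ => ?_
  simp [decodingRow, Matrix.row_def]

theorem errorSpace_eq_span (k : N.Code w F) (t : V) (ρ : Finset E) :
    N.errorSpace k t ρ =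
      Submodule.span F ((fun e => N.decodingRow k t (Sum.inr e)) '' (ρ : Set E)) := by
  rw [errorSpace, map_vectorsOn, Set.image_image]

theorem messageSpace_eq_span (k : N.Code w F) (t : V) :
    N.messageSpace k t =
      Submodule.span F (Set.range fun i : Fin w => N.decodingRow k t (Sum.inl i)) := by
  rw [messageSpace, map_vectorsOn, ← Set.range_comp]; rfl

theorem errorSpace_mono (k : N.Code w F) (t : V) {ρ ρ' : Finset E} (h : ρ ⊆ ρ') :
    N.errorSpace k t ρ ≤ N.errorSpace k t ρ' := by
  rw [errorSpace_eq_span, errorSpace_eq_span]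
  exact Submodule.span_mono (Set.image_mono (by exact_mod_cast h))

end Kernels

/-! ### Menger's theorem, deduced from Hall's theorem. -/

section Linkings

variable {V E : Type*} [Fintype V] [DecidableEq V] [Fintype E] [DecidableEq E]
  (N : MulticastNetwork V E) {w : ℕ}

/-- `C` separates the set `A` of channels from `In(t)`: the channels which can be reached from `A`
without passing through `C` lie in a set `X` as below. -/
def Separates (t : V) (A C : Finset (Fin w ⊕ E)) : Prop :=
  ∃ X : Finset (Fin w ⊕ E), A ⊆ X ∧ ∀ x ∈ X, x ∉ C →
    (∀ e, x = Sum.inr e → N.head e ≠ t) ∧ ∀ e, N.chanHead x = N.tail e → Sum.inr e ∈ X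

/-- A system of `|A|` disjoint paths from `A` to `In(t)`, given by the set of the channels on the
paths and the map to the previous channel. -/
structure Linking (w : ℕ) (t : V) (A : Finset (Fin w ⊕ E)) where
  carrier : Set (Fin w ⊕ E)
  pred : Fin w ⊕ E → Fin w ⊕ E
  subset_carrier : ∀ x ∈ A, x ∈ carrier
  pred_mem : ∀ x ∈ carrier, x ∉ A → pred x ∈ carrier
  pred_adj : ∀ x ∈ carrier, x ∉ A → ∃ e, x = Sum.inr e ∧ N.chanHead (pred x) = N.tail e
  exists_pred_eq : ∀ x ∈ carrier, (∃ e, x = Sum.inr e ∧ N.head e = t) ∨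
    ∃ y ∈ carrier, y ∉ A ∧ pred y = x

/-- Menger's theorem for the channels of a network. -/
theorem exists_linking (t : V) (A : Finset (Fin w ⊕ E))
    (hA : ∀ C, N.Separates t A C → A.card ≤ C.card) : Nonempty (N.Linking w t A) := by
  classical
  let D := {x : Fin w ⊕ E // ∀ e, x = Sum.inr e → N.head e ≠ t}
  -- Each x is its own neighbour, so that channels off the paths can be matched to themselves.
  let nbr : Fin w ⊕ E → Finset (Fin w ⊕ E) := fun x =>
    Finset.univ.filter fun y => y = x ∨ ∃ e, y = Sum.inr e ∧ N.chanHead x = N.tail e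
  have hall : ∀ X : Finset D, X.card ≤ (X.biUnion fun x => nbr x.1 \ A).card := by
    intro X
    let X' : Finset (Fin w ⊕ E) := X.map (Function.Embedding.subtype _)
    let Y := X'.biUnion nbr
    have hX'Y : X' ⊆ Y := fun x hx =>
      Finset.mem_biUnion.2 ⟨x, hx, by simp [nbr]⟩
    -- Outside this set, A ∪ Y is closed under successors and avoids In(t). Comparing |A| with |A ∪
    -- Y| - |X'| is Hall's condition.
    have hsep : N.Separates t A ((A ∪ Y) \ X') := by
      refine ⟨A ∪ Y, Finset.subset_union_left, fun x hx hxC => ?_⟩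
      have hxX : x ∈ X' := by
        by_contra h
        exact hxC (Finset.mem_sdiff.2 ⟨hx, h⟩)
      refine ⟨?_, fun e he => Finset.mem_union_right _ (Finset.mem_biUnion.2 ⟨x, hxX, ?_⟩)⟩
      · obtain ⟨x', _, rfl⟩ := Finset.mem_map.1 hxX
        exact x'.2
      · simp only [nbr, Finset.mem_filter, Finset.mem_univ, true_and]
        exact Or.inr ⟨e, rfl, he⟩
    have h1 := hA _ hsep
    have h2 : (X.biUnion fun x => nbr x.1 \ A) = Y \ A := by
      ext y
      simp only [Finset.mem_biUnion, Finset.mem_sdiff, Y, X', Finset.mem_map]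
      constructor
      · rintro ⟨x, hx, hy, hyA⟩
        exact ⟨⟨x.1, ⟨x, hx, rfl⟩, hy⟩, hyA⟩
      · rintro ⟨⟨_, ⟨x, hx, rfl⟩, hy⟩, hyA⟩
        exact ⟨x, hx, hy, hyA⟩
    have h3 : X'.card = X.card := Finset.card_map _
    have h4 : ((A ∪ Y) \ X').card = (A ∪ Y).card - X'.card :=
      Finset.card_sdiff_of_subset (hX'Y.trans Finset.subset_union_right)
    have h5 : X'.card ≤ (A ∪ Y).card :=
      Finset.card_le_card (hX'Y.trans Finset.subset_union_right)
    have h6 : (A ∪ Y).card = A.card + (Y \ A).card := by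
      rw [← Finset.card_union_of_disjoint Finset.disjoint_sdiff, Finset.union_sdiff_self_eq_union]
    rw [h2]
    by_cases hc : A.card = 0
    · have : A = ∅ := Finset.card_eq_zero.1 hc
      subst this
      simp only [Finset.sdiff_empty]
      rw [← h3]; exact Finset.card_le_card hX'Y
    · omega
  obtain ⟨n, hn, hmem⟩ := (Finset.all_card_le_biUnion_card_iff_exists_injective _).1 hall
  have hnA : ∀ x, n x ∉ A := fun x => (Finset.mem_sdiff.1 (hmem x)).2
  have hnadj : ∀ x, n x = x.1 ∨ ∃ e, n x = Sum.inr e ∧ N.chanHead x.1 = N.tail e := fun x => by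
    simpa [nbr] using (Finset.mem_sdiff.1 (hmem x)).1
  let P : Set (Fin w ⊕ E) := {x | ∃ a ∈ A,
    Relation.ReflTransGen (fun x y => ∃ h, n ⟨x, h⟩ = y) a x}
  have hPn : ∀ x ∈ P, ∀ h, n ⟨x, h⟩ ∈ P := fun x ⟨a, ha, hax⟩ h =>
    ⟨a, ha, hax.tail ⟨h, rfl⟩⟩
  -- By injectivity a fixed point on an orbit pulls back to the starting point in A, which `n`
  -- avoids. So the orbits from A are genuine paths.
  have hne : ∀ x ∈ P, ∀ h, n ⟨x, h⟩ ≠ x := by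
    rintro x ⟨a, ha, hax⟩
    induction hax with
    | refl => exact fun h he => hnA ⟨a, h⟩ (he.symm ▸ ha)
    | @tail y z hay hyz ih =>
      intro h he
      obtain ⟨hy, rfl⟩ := hyz
      have := hn he
      exact ih hy (congrArg Subtype.val this)
  have hpre : ∀ x ∈ P, x ∉ A → ∃ y ∈ P, ∃ h, n ⟨y, h⟩ = x := by
    rintro x ⟨a, ha, hax⟩ hxA
    rcases Relation.ReflTransGen.cases_tail hax with rfl | ⟨y, hay, hyx⟩
    · exact absurd ha hxA
    · exact ⟨y, ⟨a, ha, hay⟩, hyx⟩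
  choose! p hpP hp using hpre
  refine ⟨⟨P, p, fun a ha => ⟨a, ha, .refl⟩, hpP, fun x hx hxA => ?_, fun x hx => ?_⟩⟩
  · obtain ⟨h, hpx⟩ := hp x hx hxA
    rcases hnadj ⟨p x, h⟩ with h' | ⟨e, he, hadj⟩
    · exact absurd h' (hne _ (hpP x hx hxA) h)
    · exact ⟨e, hpx.symm.trans he, hadj⟩
  · by_cases h : ∀ e, x = Sum.inr e → N.head e ≠ t
    · refine Or.inr ⟨n ⟨x, h⟩, hPn x hx h, hnA _, ?_⟩
      obtain ⟨h', hp'⟩ := hp _ (hPn x hx h) (hnA _)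
      exact congrArg Subtype.val (hn hp')
    · push Not at h
      exact Or.inl h

end Linkings

/-! ### Separators, domination and cuts. -/

section Domination

variable {V E : Type*} [Fintype V] [DecidableEq V] [Fintype E] [DecidableEq E]
  (N : MulticastNetwork V E) {w : ℕ} (F : Type*) [Field F]

theorem wellFounded_adj_swap : WellFounded (fun d e : E => N.head e = N.tail d) := by
  have hV : WellFounded (fun a b : V =>
      Relation.TransGen (fun a b => ∃ e, N.tail e = a ∧ N.head e = b) b a) := by
    have : IsTrans V (fun a b : V =>
        Relation.TransGen (fun a b => ∃ e, N.tail e = a ∧ N.head e = b) b a) :=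
      ⟨fun _ _ _ h₁ h₂ => h₂.trans h₁⟩
    have : Std.Irrefl (fun a b : V =>
        Relation.TransGen (fun a b => ∃ e, N.tail e = a ∧ N.head e = b) b a) :=
      ⟨N.acyclic⟩
    exact Finite.wellFounded_of_trans_of_irrefl _
  refine Subrelation.wf ?_ (InvImage.wf N.tail hV)
  intro d e h
  exact Relation.TransGen.single ⟨e, rfl, h⟩

/-- Unfolding the row recursion from ρ stops only at C. Message channels in C can be dropped, since
no channel leads to them. -/
theorem dominated_of_separates {t : V} {ρ : Finset E} {A C : Finset (Fin w ⊕ E)}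
    (hρ : ∀ e ∈ ρ, Sum.inr e ∈ A) (hC : N.Separates t A C) :
    N.Dominated w F t ρ C.toRight := by
  obtain ⟨X, hAX, hX⟩ := hC
  intro k
  rw [errorSpace_eq_span, errorSpace_eq_span, Submodule.span_le]
  rintro _ ⟨e, he, rfl⟩
  have key : ∀ e, Sum.inr e ∈ X → N.decodingRow k t (Sum.inr e) ∈
      Submodule.span F ((fun e => N.decodingRow k t (Sum.inr e)) '' (C.toRight : Set E)) := by
    intro e
    induction e using N.wellFounded_adj_swap.induction with
    | _ e ih =>
      intro heX
      by_cases heC : Sum.inr e ∈ C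
      · exact Submodule.subset_span ⟨e, by simpa using heC, rfl⟩
      · rw [decodingRow_eq N k t _ (hX _ heX heC).1]
        refine Submodule.sum_mem _ fun e' _ => ?_
        by_cases h : N.head e = N.tail e'
        · exact Submodule.smul_mem _ _ (ih e' h ((hX _ heX heC).2 e' h))
        · rw [coef_eq_zero N k (by exact h), zero_smul]
          exact Submodule.zero_mem _
  exact key e (hAX (hρ e he))

variable {F} in
theorem Dominated.patternRank_le {t : V} {ρ ρ' : Finset E} (h : N.Dominated w F t ρ ρ') :
    N.patternRank w F t ρ ≤ ρ'.card := Nat.sInf_le ⟨ρ', h, rfl⟩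

theorem exists_dominated_card_eq_patternRank (t : V) (ρ : Finset E) :
    ∃ ρ', N.Dominated w F t ρ ρ' ∧ ρ'.card = N.patternRank w F t ρ :=
  Nat.sInf_mem (s := {n | ∃ ρ' : Finset E, N.Dominated w F t ρ ρ' ∧ ρ'.card = n})
    ⟨_, ρ, fun _ => le_rfl, rfl⟩

theorem exists_linking_errorPattern {t : V} {ρ : Finset E} (hρ : N.patternRank w F t ρ = ρ.card) :
    Nonempty (N.Linking w t (ρ.map Function.Embedding.inr)) := by
  refine N.exists_linking t _ fun C hC => ?_
  rw [Finset.card_map, ← hρ]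
  exact (N.dominated_of_separates F (by simp) hC).patternRank_le.trans Finset.card_toRight_le

theorem IsCut.minCut_le {t : V} {C : Finset E} (h : N.IsCut t C) : N.minCut t ≤ C.card :=
  Nat.sInf_le ⟨C, h, rfl⟩

/-- A message channel outside C opens the source: a path from there avoiding C never leaves X, hence
cannot end in t. -/
theorem isCut_of_separates {t : V} (ht : t ∈ N.sinks) {A C : Finset (Fin w ⊕ E)} {i : Fin w}
    (hiA : Sum.inl i ∈ A) (hiC : Sum.inl i ∉ C) (hC : N.Separates t A C) :
    N.IsCut t C.toRight := by
  obtain ⟨X, hAX, hX⟩ := hC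
  intro hpath
  have key : ∀ v, Relation.ReflTransGen
      (fun a b => ∃ e, e ∉ C.toRight ∧ N.tail e = a ∧ N.head e = b) N.source v →
      ∃ x ∈ X, x ∉ C ∧ N.chanHead x = v := by
    intro v hv
    induction hv with
    | refl => exact ⟨_, hAX hiA, hiC, rfl⟩
    | tail _ h ih =>
      obtain ⟨x, hx, hxC, rfl⟩ := ih
      obtain ⟨e, heC, het, rfl⟩ := h
      exact ⟨Sum.inr e, (hX x hx hxC).2 e het.symm, by simpa using heC, rfl⟩
  obtain ⟨x, hx, hxC, hxt⟩ := key t hpath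
  rcases x with j | e
  · exact N.source_notMem_sinks ((show N.source = t from hxt) ▸ ht)
  · exact (hX _ hx hxC).1 e rfl hxt

/-- The imaginary message channels together with an error pattern. -/
def withMessages (w : ℕ) (ρ : Finset E) : Finset (Fin w ⊕ E) := Finset.univ.disjSum ρ

theorem exists_linking_withMessages {t : V} (ht : t ∈ N.sinks) (hw : w ≤ N.minCut t)
    {ρ : Finset E} (hρ : ρ ∈ N.fullRankPatterns w F t) :
    Nonempty (N.Linking w t (withMessages w ρ)) := by
  obtain ⟨hcard, hrank⟩ : ρ.card = N.redundancy w t ∧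
    N.patternRank w F t ρ = N.redundancy w t := by simpa [fullRankPatterns] using hρ
  refine N.exists_linking t _ fun C hC => ?_
  rw [withMessages, Finset.card_disjSum, Finset.card_univ, Fintype.card_fin]
  have hCcard := Finset.card_toLeft_add_card_toRight (u := C)
  -- Either C contains all w message channels and its remainder dominates ρ, costing at least δ_t
  -- more, or its network part is a cut of size at least w + δ_t.
  by_cases h : ∀ i, Sum.inl i ∈ C
  · have h1 : C.toLeft = Finset.univ := by ext i; simpa using h i
    rw [h1, Finset.card_univ, Fintype.card_fin] at hCcard
    have := (N.dominated_of_separates F (ρ := ρ) (by simp [withMessages]) hC).patternRank_le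
    omega
  · push Not at h
    obtain ⟨i, hi⟩ := h
    have := (N.isCut_of_separates ht (i := i) (by simp [withMessages]) hi hC).minCut_le
    unfold redundancy at *
    omega

end Domination

/-! ### Processing one node, with the counting injection. -/

section Step

variable {V E F : Type*} [Fintype V] [DecidableEq V] [Fintype E] [DecidableEq E] [Field F]
  {N : MulticastNetwork V E} {w : ℕ}

/-- The code which results from `k` if all channels with tail outside `S` transmit `0`. -/
def trunc (S : Finset V) (k : N.Code w F) : N.Code w F :=
  fun p => if N.tail p.1.2 ∈ S then k p else 0

theorem coef_trunc (S : Finset V) (k : N.Code w F) (d : Fin w ⊕ E) (e : E) :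
    N.coef (trunc S k) d e = if N.tail e ∈ S then N.coef k d e else 0 := by
  unfold coef trunc
  split_ifs <;> rfl

theorem extKernel_trunc_of_notMem {S : Finset V} (k : N.Code w F) {e : E} (he : N.tail e ∉ S) :
    N.extKernel (trunc S k) (Sum.inr e) = Pi.single (Sum.inr e) 1 := by
  rw [extKernel_inr_coef, Finset.sum_eq_zero, zero_add]
  intro d _
  rw [coef_trunc, if_neg he, zero_smul]

/-- A set of nodes which contains with a node all its predecessors. -/
def PredClosed (N : MulticastNetwork V E) (S : Finset V) : Prop :=
  ∀ e, N.head e ∈ S → N.tail e ∈ S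

theorem head_ne_of_tail_eq {v : V} {e : E} (he : N.tail e = v) : N.head e ≠ v := fun h =>
  N.acyclic v (Relation.TransGen.single ⟨e, he, h⟩)

/-- Channels starting in S depend only on channels starting in S, and those starting outside `insert
v S` carry only their own indicator. -/
theorem extKernel_trunc_insert {S : Finset V} (hS : N.PredClosed S) {v : V} (hv : v ∉ S)
    (k : N.Code w F) (d : Fin w ⊕ E) (hd : ∀ e, d = Sum.inr e → N.tail e ≠ v) :
    N.extKernel (trunc (insert v S) k) d = N.extKernel (trunc S k) d := by
  rcases d with i | e
  · rfl
  replace hd := hd e rfl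
  induction e using N.wellFounded_adj.induction with
  | _ e ih =>
    by_cases he : N.tail e ∈ S
    · rw [extKernel_inr_coef, extKernel_inr_coef]
      congr 1
      refine Finset.sum_congr rfl fun d _ => ?_
      rw [coef_trunc, coef_trunc, if_pos he, if_pos (Finset.mem_insert_of_mem he)]
      rcases d with i | c
      · rfl
      by_cases hc : N.head c = N.tail e
      · have : N.tail c ∈ S := hS c (hc ▸ he)
        rw [ih c hc fun h => hv (h ▸ this)]
      · rw [coef_eq_zero N k (by exact hc), zero_smul, zero_smul]
    · rw [extKernel_trunc_of_notMem k he, extKernel_trunc_of_notMem k (by simp [he, hd])]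

theorem extKernel_trunc_insert_self {S : Finset V} (hS : N.PredClosed S) {v : V} (hv : v ∉ S)
    (k : N.Code w F) {e : E} (he : N.tail e = v) :
    N.extKernel (trunc (insert v S) k) (Sum.inr e) =
      (∑ d, N.coef k d e • N.extKernel (trunc S k) d) + Pi.single (Sum.inr e) 1 := by
  rw [extKernel_inr_coef]
  congr 1
  refine Finset.sum_congr rfl fun d _ => ?_
  rw [coef_trunc, if_pos (he ▸ Finset.mem_insert_self _ _)]
  by_cases hd : N.chanHead d = N.tail e
  · rw [extKernel_trunc_insert hS hv]
    rintro c rfl hc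
    exact head_ne_of_tail_eq hc (hd.trans he)
  · rw [coef_eq_zero N k hd, zero_smul, zero_smul]

namespace Linking

variable {t : V} {A : Finset (Fin w ⊕ E)}

/-- The last channels of the paths of a linking after the nodes of `S` have been processed. -/
def frontier (L : N.Linking w t A) (S : Finset V) : Set (Fin w ⊕ E) :=
  {d | d ∈ L.carrier ∧ (d ∈ A ∨ ∃ e, d = Sum.inr e ∧ N.tail e ∈ S) ∧
    ∀ e, Sum.inr e ∈ L.carrier → Sum.inr e ∉ A → N.tail e ∈ S → L.pred (Sum.inr e) ≠ d}

/-- The parts in `A` of the kernels of the channels in the frontier span the space of all vectors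
on `A`. -/
def FullRank (L : N.Linking w t A) (S : Finset V) (k : N.Code w F) : Prop :=
  ∀ y : Fin w ⊕ E → F, (∀ d ∉ A, y d = 0) →
    (∀ d ∈ L.frontier S, y ⬝ᵥ N.extKernel k d = 0) → y = 0

theorem fullRank_empty (L : N.Linking w t A) (k : N.Code w F) :
    L.FullRank ∅ (trunc ∅ k) := by
  intro y hy h
  funext d
  by_cases hd : d ∈ A
  · have := h d ⟨L.subset_carrier d hd, Or.inl hd, by simp⟩
    rcases d with i | e
    · simpa [extKernel] using this
    · simpa [extKernel_trunc_of_notMem] using this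
  · exact hy d hd

theorem mem_frontier_insert (L : N.Linking w t A) {S : Finset V} (hS : N.PredClosed S) {v : V}
    (hv : v ∉ S) {e : E} (he : Sum.inr e ∈ L.carrier) (hev : N.tail e = v) :
    Sum.inr e ∈ L.frontier (insert v S) := by
  refine ⟨he, Or.inr ⟨e, rfl, hev ▸ Finset.mem_insert_self _ _⟩, fun e' he' hA hS' hp => ?_⟩
  obtain ⟨e'', h1, h2⟩ := L.pred_adj _ he' hA
  obtain rfl := Sum.inr_injective h1
  rw [hp] at h2
  replace h2 : N.head e = N.tail e' := h2
  rw [← h2] at hS'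
  rcases Finset.mem_insert.1 hS' with h | h
  · exact head_ne_of_tail_eq hev h
  · exact hv (hev ▸ hS e h)

/-- The channels of a linking with tail `v`. -/
abbrev Out (L : N.Linking w t A) (v : V) : Type _ :=
  {e : E // Sum.inr e ∈ L.carrier ∧ N.tail e = v}

/-- The channel of the frontier which is replaced by `e`. -/
def replaced (L : N.Linking w t A) (e : E) : Fin w ⊕ E :=
  if Sum.inr e ∈ A then Sum.inr e else L.pred (Sum.inr e)

/-- The values at the channels which are replaced when the node `v` is processed. -/
noncomputable def replacedValues (L : N.Linking w t A) (v : V) (k : N.Code w F) :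
    (Fin w ⊕ E → F) →ₗ[F] (L.Out v → F) where
  toFun y e := y ⬝ᵥ N.extKernel k (L.replaced e.1)
  map_add' _ _ := by funext; simp [add_dotProduct]
  map_smul' _ _ := by funext; simp

/-- The vectors on `A` orthogonal to the kernels of the channels which stay in the frontier when
the node `v` is processed. -/
def OrthogonalToStaying (L : N.Linking w t A) (S : Finset V) (v : V) (k : N.Code w F)
    (y : Fin w ⊕ E → F) : Prop :=
  (∀ d ∉ A, y d = 0) ∧ ∀ d ∈ L.frontier (insert v S), (∀ e, d = Sum.inr e → N.tail e ≠ v) →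
    y ⬝ᵥ N.extKernel k d = 0

/-- Every channel of the old frontier either stays or is replaced by a channel leaving v. -/
theorem FullRank.eq_zero_of_replacedValues {L : N.Linking w t A} {S : Finset V} {k : N.Code w F}
    (hk : L.FullRank S k) {v : V} (hv : v ∉ S) {y : Fin w ⊕ E → F}
    (hy : L.OrthogonalToStaying S v k y) (h : L.replacedValues v k y = 0) : y = 0 := by
  refine hk y hy.1 fun d hd => ?_
  by_cases h1 : ∃ e, d = Sum.inr e ∧ N.tail e = v
  · obtain ⟨e, rfl, he⟩ := h1
    have hA : Sum.inr e ∈ A := by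
      rcases hd.2.1 with h | ⟨e', h, h'⟩
      · exact h
      · obtain rfl := Sum.inr_injective h
        exact absurd (he ▸ h') hv
    have := congrFun h ⟨e, hd.1, he⟩
    simpa [replacedValues, replaced, hA] using this
  · by_cases h2 : ∃ e, Sum.inr e ∈ L.carrier ∧ Sum.inr e ∉ A ∧ N.tail e = v ∧
      L.pred (Sum.inr e) = d
    · obtain ⟨e, he, hA, hev, rfl⟩ := h2
      have := congrFun h ⟨e, he, hev⟩
      simpa [replacedValues, replaced, hA] using this
    · refine hy.2 d ⟨hd.1, hd.2.1.imp_right ?_, ?_⟩ fun e he hev => h1 ⟨e, he, hev⟩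
      · rintro ⟨e, he, h⟩
        exact ⟨e, he, Finset.mem_insert_of_mem h⟩
      · intro e he hA hS hp
        rcases Finset.mem_insert.1 hS with h | h
        · exact h2 ⟨e, he, hA, h, hp⟩
        · exact hd.2.2 e he hA h hp

theorem FullRank.injOn_replacedValues {L : N.Linking w t A} {S : Finset V} {k : N.Code w F}
    (hk : L.FullRank S k) {v : V} (hv : v ∉ S) {y z : Fin w ⊕ E → F}
    (hy : L.OrthogonalToStaying S v k y) (hz : L.OrthogonalToStaying S v k z)
    (h : L.replacedValues v k y = L.replacedValues v k z) : y = z := by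
  rw [← sub_eq_zero]
  refine hk.eq_zero_of_replacedValues hv ⟨fun d hd => ?_, fun d hd hdv => ?_⟩ ?_
  · simp [hy.1 d hd, hz.1 d hd]
  · simp [sub_dotProduct, hy.2 d hd hdv, hz.2 d hd hdv]
  · rw [map_sub, h, sub_self]

/-- Change the coefficients of the channels of a linking with tail `v`. -/
noncomputable def shift (L : N.Linking w t A) (v : V) (ψ : Fin w ⊕ E → F) (c : L.Out v → F) (k : N.Code w F) :
    N.Code w F := fun p =>
  k p + (open Classical in if h : Sum.inr p.1.2 ∈ L.carrier ∧ N.tail p.1.2 = v then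
    ψ p.1.1 * c ⟨p.1.2, h⟩ else 0)

theorem coef_shift (L : N.Linking w t A) {v : V} {ψ : Fin w ⊕ E → F}
    (hψ : ∀ d, N.chanHead d ≠ v → ψ d = 0) (c : L.Out v → F) (k : N.Code w F)
    (d : Fin w ⊕ E) (e : L.Out v) :
    N.coef (L.shift v ψ c k) d e.1 = N.coef k d e.1 + ψ d * c e := by
  unfold coef shift
  split_ifs with h1 h2
  · rfl
  · exact absurd e.2 h2
  · rw [hψ d fun h => h1 (h.trans e.2.2.symm)]; simp

theorem trunc_shift (L : N.Linking w t A) {S : Finset V} {v : V} (hv : v ∉ S)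
    (ψ : Fin w ⊕ E → F) (c : L.Out v → F) (k : N.Code w F) :
    trunc S (L.shift v ψ c k) = trunc S k := by
  funext p
  unfold trunc shift
  split_ifs with h1 h2
  · exact absurd (h2.2 ▸ h1) hv
  · rw [add_zero]
  · rfl

theorem dotProduct_extKernel_shift (L : N.Linking w t A) {S : Finset V} (hS : N.PredClosed S)
    {v : V} (hv : v ∉ S) {ψ : Fin w ⊕ E → F} (hψ : ∀ d, N.chanHead d ≠ v → ψ d = 0)
    (c : L.Out v → F) (k : N.Code w F) (y : Fin w ⊕ E → F) (e : L.Out v) :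
    y ⬝ᵥ N.extKernel (trunc (insert v S) (L.shift v ψ c k)) (Sum.inr e.1) =
      y ⬝ᵥ N.extKernel (trunc (insert v S) k) (Sum.inr e.1) +
        (∑ d, ψ d * (y ⬝ᵥ N.extKernel (trunc S k) d)) * c e := by
  rw [extKernel_trunc_insert_self hS hv _ e.2.2, extKernel_trunc_insert_self hS hv _ e.2.2,
    L.trunc_shift hv]
  simp only [L.coef_shift hψ, add_smul, Finset.sum_add_distrib, dotProduct_add, dotProduct_sum,
    dotProduct_smul, smul_eq_mul, Finset.sum_mul]
  rw [add_right_comm]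
  congr 1
  exact Finset.sum_congr rfl fun d _ => by ring

theorem orthogonalToStaying_of_frontier (L : N.Linking w t A) {S : Finset V}
    (hS : N.PredClosed S) {v : V} (hv : v ∉ S) {k : N.Code w F} {y : Fin w ⊕ E → F}
    (hyA : ∀ d ∉ A, y d = 0)
    (hy : ∀ d ∈ L.frontier (insert v S), y ⬝ᵥ N.extKernel (trunc (insert v S) k) d = 0) :
    L.OrthogonalToStaying S v (trunc S k) y := by
  refine ⟨hyA, fun d hd hdv => ?_⟩
  rw [← extKernel_trunc_insert hS hv k d hdv]
  exact hy d hd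

/-- If y killed all kernels entering v, its values on the channels leaving v would reduce to their
own indicators; then all replaced values vanish and y = 0. -/
theorem FullRank.exists_dotProduct_ne_zero {L : N.Linking w t A} {S : Finset V}
    (hS : N.PredClosed S) {v : V} (hv : v ∉ S) {k : N.Code w F} (hk : L.FullRank S (trunc S k))
    {y : Fin w ⊕ E → F} (hyA : ∀ d ∉ A, y d = 0)
    (hy : ∀ d ∈ L.frontier (insert v S), y ⬝ᵥ N.extKernel (trunc (insert v S) k) d = 0)
    (hy0 : y ≠ 0) : ∃ d, N.chanHead d = v ∧ y ⬝ᵥ N.extKernel (trunc S k) d ≠ 0 := by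
  by_contra! h
  refine hy0 (hk.eq_zero_of_replacedValues hv
    (L.orthogonalToStaying_of_frontier hS hv hyA hy) ?_)
  funext ⟨e, he, hev⟩
  change y ⬝ᵥ N.extKernel (trunc S k) (L.replaced e) = 0
  unfold replaced
  split_ifs with hA
  · have h1 := hy _ (L.mem_frontier_insert hS hv he hev)
    rw [extKernel_trunc_insert_self hS hv _ hev, dotProduct_add, dotProduct_sum,
      Finset.sum_eq_zero, zero_add] at h1
    · rwa [extKernel_trunc_of_notMem k (hev ▸ hv)]
    · intro d _
      rw [dotProduct_smul]
      by_cases hd : N.chanHead d = N.tail e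
      · rw [h d (hd.trans hev), smul_zero]
      · rw [coef_eq_zero N k hd, zero_smul]
  · obtain ⟨e', h1, h2⟩ := L.pred_adj _ he hA
    obtain rfl := Sum.inr_injective h1
    exact h _ (h2.trans hev)

open Classical in
/-- When the node `v` is processed, less than one in `|F| - 1` codes loses the full rank. -/
theorem card_not_fullRank_insert_lt [Fintype F] (L : N.Linking w t A) {S : Finset V}
    (hS : N.PredClosed S) {v : V} (hv : v ∉ S) {G : Finset (N.Code w F)} (hG0 : G.Nonempty)
    (hG : ∀ k k', trunc S k = trunc S k' → k ∈ G → k' ∈ G)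
    (hGL : ∀ k ∈ G, L.FullRank S (trunc S k)) :
    (G.filter fun k => ¬ L.FullRank (insert v S) (trunc (insert v S) k)).card *
      (Fintype.card F - 1) < G.card := by
  set B := G.filter fun k => ¬ L.FullRank (insert v S) (trunc (insert v S) k) with hB
  have hY : ∀ k ∈ B, ∃ y : Fin w ⊕ E → F, (∀ d ∉ A, y d = 0) ∧
      (∀ d ∈ L.frontier (insert v S), y ⬝ᵥ N.extKernel (trunc (insert v S) k) d = 0) ∧
      y ≠ 0 := by
    intro k hk
    have := (Finset.mem_filter.1 hk).2
    unfold FullRank at this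
    push Not at this
    exact this
  choose! y hyA hyS hy0 using hY
  -- ψ depends only on the truncated code and on z, so it can be recomputed from the image of the
  -- injection below.
  have hψ : ∀ (κ : N.Code w F) (z : Fin w ⊕ E → F), ∃ ψ : Fin w ⊕ E → F,
      (∀ d, N.chanHead d ≠ v → ψ d = 0) ∧
      ((∃ d, N.chanHead d = v ∧ z ⬝ᵥ N.extKernel κ d ≠ 0) →
        ∑ d, ψ d * (z ⬝ᵥ N.extKernel κ d) = 1) := by
    intro κ z
    by_cases h : ∃ d, N.chanHead d = v ∧ z ⬝ᵥ N.extKernel κ d ≠ 0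
    · obtain ⟨d, hd, hz⟩ := h
      refine ⟨Pi.single d (z ⬝ᵥ N.extKernel κ d)⁻¹, fun d' hd' => ?_, fun _ => ?_⟩
      · exact Pi.single_eq_of_ne (by rintro rfl; exact hd' hd) _
      · rw [Finset.sum_eq_single d]
        · rw [Pi.single_eq_same, inv_mul_cancel₀ hz]
        · intro d' _ hd'
          rw [Pi.single_eq_of_ne hd', zero_mul]
        · simp
    · exact ⟨0, fun _ _ => rfl, fun h' => absurd h' h⟩
  choose ψ hψv hψ1 using hψ
  have hzA : ∀ k ∈ B, ∀ a : Fˣ, ∀ d ∉ A, ((a : F) • y k) d = 0 := fun k hk a d hd => by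
    simp [hyA k hk d hd]
  have hzS : ∀ k ∈ B, ∀ a : Fˣ, ∀ d ∈ L.frontier (insert v S),
      ((a : F) • y k) ⬝ᵥ N.extKernel (trunc (insert v S) k) d = 0 := fun k hk a d hd => by
    rw [smul_dotProduct, hyS k hk d hd, smul_zero]
  have hz0 : ∀ k ∈ B, ∀ a : Fˣ, (a : F) • y k ≠ 0 := fun k hk a =>
    smul_ne_zero a.ne_zero (hy0 k hk)
  have hBG : ∀ k ∈ B, k ∈ G := fun k hk => (Finset.mem_filter.1 hk).1
  -- A bad code k, a unit a and a vector c go to the code shifted by c and the replaced values of z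
  -- = a y. Decoding: the shift leaves the truncation to S unchanged, so the replaced values
  -- determine z; z kills the channels of the linking leaving v under k, so its values there under
  -- the shifted code are c; undoing the shift gives k, hence y and a.
  have hinj : (B ×ˢ (Finset.univ : Finset (Fˣ × (L.Out v → F)))).card ≤
      (G ×ˢ (Finset.univ.erase (0 : L.Out v → F))).card := by
    refine Finset.card_le_card_of_injOn
      (fun p => (L.shift v (ψ (trunc S p.1) ((p.2.1 : F) • y p.1)) p.2.2 p.1,
        L.replacedValues v (trunc S p.1) ((p.2.1 : F) • y p.1))) ?_ ?_
    · rintro ⟨k, a, c⟩ hp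
      have hk : k ∈ B := by simpa using hp
      simp only [Finset.coe_product, Set.mem_prod, Finset.mem_coe, Finset.mem_erase,
        Finset.mem_univ, and_true]
      refine ⟨hG k _ (L.trunc_shift hv _ _ _).symm (hBG k hk), fun h => hz0 k hk a ?_⟩
      exact (hGL k (hBG k hk)).eq_zero_of_replacedValues hv
        (L.orthogonalToStaying_of_frontier hS hv (hzA k hk a) (hzS k hk a)) h
    · rintro ⟨k, a, c⟩ hp ⟨k', a', c'⟩ hp' h
      have hk : k ∈ B := by simpa using hp
      have hk' : k' ∈ B := by simpa using hp'
      simp only [Prod.mk.injEq] at h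
      obtain ⟨h1, h2⟩ := h
      have ht : trunc S k = trunc S k' := by
        rw [← L.trunc_shift hv _ c k, h1, L.trunc_shift hv]
      have hyy : (a : F) • y k = (a' : F) • y k' := by
        refine (hGL k (hBG k hk)).injOn_replacedValues hv
          (L.orthogonalToStaying_of_frontier hS hv (hzA k hk a) (hzS k hk a)) ?_ (ht ▸ h2)
        rw [ht]
        exact L.orthogonalToStaying_of_frontier hS hv (hzA k' hk' a') (hzS k' hk' a')
      have hval : ∀ k ∈ B, ∀ (a : Fˣ) (c : L.Out v → F) (e : L.Out v),
          ((a : F) • y k) ⬝ᵥ N.extKernel (trunc (insert v S)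
            (L.shift v (ψ (trunc S k) ((a : F) • y k)) c k)) (Sum.inr e.1) = c e := by
        intro k hk a c e
        rw [L.dotProduct_extKernel_shift hS hv (hψv _ _), hψ1, one_mul,
          hzS k hk a _ (L.mem_frontier_insert hS hv e.2.1 e.2.2), zero_add]
        exact (hGL k (hBG k hk)).exists_dotProduct_ne_zero hS hv (hzA k hk a) (hzS k hk a)
          (hz0 k hk a)
      have hc : c = c' := by
        funext e
        rw [← hval k hk a c e, ← hval k' hk' a' c' e, h1, hyy]
      have hkk : k = k' := by
        rw [ht, hyy, hc] at h1
        funext p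
        exact add_right_cancel (congrFun h1 p)
      subst hkk
      have haa : a = a' := Units.ext (smul_left_injective F (hy0 k hk) hyy)
      rw [haa, hc]
  have hq : (Finset.univ.erase (0 : L.Out v → F)).card + 1 = Fintype.card (L.Out v → F) := by
    rw [Finset.card_erase_of_mem (Finset.mem_univ _), Finset.card_univ]
    exact Nat.sub_add_cancel Fintype.card_pos
  rw [Finset.card_product, Finset.card_product, Finset.card_univ, Fintype.card_prod,
    Fintype.card_units, ← mul_assoc, ← hq] at hinj
  -- With m channels of the linking leaving v, the injection reads |B| (q - 1) q^m ≤ |G| (q^m - 1),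
  -- which is less than |G| q^m.
  by_contra! hle
  have := (Nat.mul_le_mul_right ((Finset.univ.erase (0 : L.Out v → F)).card + 1) hle).trans hinj
  have := hG0.card_pos
  nlinarith

end Linking

end Step

/-! ### Union bound and induction over the nodes. -/

section Count

variable {V E F : Type*} [Fintype V] [DecidableEq V] [Fintype E] [DecidableEq E] [Field F]
  [Fintype F] {N : MulticastNetwork V E} {w : ℕ}

/-- A nonempty set of nodes has an element none of whose successors lies in the set. -/
theorem exists_forall_head_notMem {S : Finset V} (hS : S.Nonempty) :
    ∃ v ∈ S, ∀ e, N.tail e = v → N.head e ∉ S := by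
  have : IsTrans V (fun a b : V =>
      Relation.TransGen (fun a b => ∃ e, N.tail e = a ∧ N.head e = b) b a) :=
    ⟨fun _ _ _ h₁ h₂ => h₂.trans h₁⟩
  have : Std.Irrefl (fun a b : V =>
      Relation.TransGen (fun a b => ∃ e, N.tail e = a ∧ N.head e = b) b a) :=
    ⟨N.acyclic⟩
  have hwf : WellFounded (fun a b : V =>
      Relation.TransGen (fun a b => ∃ e, N.tail e = a ∧ N.head e = b) b a) :=
    Finite.wellFounded_of_trans_of_irrefl _
  obtain ⟨v, hv, hmin⟩ := hwf.has_min (S : Set V) hS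
  exact ⟨v, hv, fun e he h => hmin _ h (.single ⟨e, he, rfl⟩)⟩

open Classical in
/-- The codes for which all linkings of a family have full rank after the nodes of `S` have been
processed. -/
noncomputable def fullRankCodes {ι : Type*} {t : ι → V} {A : ι → Finset (Fin w ⊕ E)}
    (F : Type*) [Field F] [Fintype F] (L : ∀ i, N.Linking w (t i) (A i)) (S : Finset V) :
    Finset (N.Code w F) :=
  Finset.univ.filter fun k => ∀ i, (L i).FullRank S (trunc S k)

theorem mem_fullRankCodes {ι : Type*} {t : ι → V} {A : ι → Finset (Fin w ⊕ E)}
    {L : ∀ i, N.Linking w (t i) (A i)} {S : Finset V} {k : N.Code w F} :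
    k ∈ fullRankCodes F L S ↔ ∀ i, (L i).FullRank S (trunc S k) := by
  simp [fullRankCodes]

variable {ι : Type*} [Fintype ι] [Nonempty ι] {t : ι → V} {A : ι → Finset (Fin w ⊕ E)}

theorem card_fullRankCodes_insert (L : ∀ i, N.Linking w (t i) (A i)) {S : Finset V}
    (hS : N.PredClosed S) {v : V} (hv : v ∉ S) (h0 : (fullRankCodes F L S).Nonempty) :
    (1 - (Fintype.card ι : ℝ) / ((Fintype.card F : ℝ) - 1)) * (fullRankCodes F L S).card <
      (fullRankCodes F L (insert v S)).card := by
  classical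
  set G := fullRankCodes F L S with hG
  set B : ι → Finset (N.Code w F) := fun i =>
    G.filter fun k => ¬ (L i).FullRank (insert v S) (trunc (insert v S) k) with hB
  have hq : (0 : ℝ) < (Fintype.card F : ℝ) - 1 := by
    have : (1 : ℝ) < Fintype.card F := by exact_mod_cast Fintype.one_lt_card
    linarith
  have hBi : ∀ i, ((B i).card : ℝ) < G.card / ((Fintype.card F : ℝ) - 1) := by
    intro i
    rw [lt_div_iff₀ hq]
    have := (L i).card_not_fullRank_insert_lt hS hv h0
      (fun k k' h hk => mem_fullRankCodes.2 (h ▸ mem_fullRankCodes.1 hk))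
      (fun k hk => mem_fullRankCodes.1 hk i)
    have h1 : ((Fintype.card F - 1 : ℕ) : ℝ) = (Fintype.card F : ℝ) - 1 := by
      rw [Nat.cast_sub Fintype.card_pos, Nat.cast_one]
    rw [← h1]
    exact_mod_cast this
  have hcover : G ⊆ fullRankCodes F L (insert v S) ∪ Finset.univ.biUnion B := by
    intro k hk
    by_cases h : ∀ i, (L i).FullRank (insert v S) (trunc (insert v S) k)
    · exact Finset.mem_union_left _ (mem_fullRankCodes.2 h)
    · push Not at h
      obtain ⟨i, hi⟩ := h
      exact Finset.mem_union_right _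
        (Finset.mem_biUnion.2 ⟨i, Finset.mem_univ _, Finset.mem_filter.2 ⟨hk, hi⟩⟩)
  have h1 : (G.card : ℝ) ≤ (fullRankCodes F L (insert v S)).card + ∑ i, ((B i).card : ℝ) := by
    exact_mod_cast (Finset.card_le_card hcover).trans ((Finset.card_union_le _ _).trans
      (Nat.add_le_add_left Finset.card_biUnion_le _))
  have h2 : ∑ i, ((B i).card : ℝ) <
      ∑ _i : ι, (G.card : ℝ) / ((Fintype.card F : ℝ) - 1) :=
    Finset.sum_lt_sum_of_nonempty Finset.univ_nonempty fun i _ => hBi i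
  rw [Finset.sum_const, Finset.card_univ, nsmul_eq_mul] at h2
  have h3 : (Fintype.card ι : ℝ) / ((Fintype.card F : ℝ) - 1) * G.card =
      Fintype.card ι * (G.card / ((Fintype.card F : ℝ) - 1)) := by ring
  rw [sub_mul, one_mul, h3]
  linarith

theorem card_fullRankCodes (L : ∀ i, N.Linking w (t i) (A i))
    (hι : (Fintype.card ι : ℝ) ≤ (Fintype.card F : ℝ) - 1) {S : Finset V} (hS : N.PredClosed S)
    (hne : S.Nonempty) :
    (1 - (Fintype.card ι : ℝ) / ((Fintype.card F : ℝ) - 1)) ^ S.card *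
      Fintype.card (N.Code w F) < (fullRankCodes F L S).card := by
  have hx : 0 ≤ 1 - (Fintype.card ι : ℝ) / ((Fintype.card F : ℝ) - 1) := by
    rw [sub_nonneg]
    exact div_le_one_of_le₀ hι ((Nat.cast_nonneg _).trans hι)
  set x := 1 - (Fintype.card ι : ℝ) / ((Fintype.card F : ℝ) - 1) with hxdef
  induction hn : S.card generalizing S with
  | zero => simp [Finset.card_eq_zero.1 hn] at hne
  | succ n ih =>
    -- Removing a topologically last node keeps S closed under predecessors.
    obtain ⟨v, hvS, hv⟩ := exists_forall_head_notMem (N := N) hne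
    have hS' : N.PredClosed (S.erase v) := fun e he =>
      Finset.mem_erase.2 ⟨fun h => hv e h (Finset.mem_of_mem_erase he),
        hS e (Finset.mem_of_mem_erase he)⟩
    have hcard : (S.erase v).card = n := by
      rw [Finset.card_erase_of_mem hvS, hn, Nat.add_sub_cancel]
    -- A weak bound suffices here, with equality for the empty set; the last node supplies
    -- strictness, which needs some surviving code.
    have hle : x ^ n * Fintype.card (N.Code w F) ≤ (fullRankCodes F L (S.erase v)).card ∧
        (fullRankCodes F L (S.erase v)).Nonempty := by
      rcases (S.erase v).eq_empty_or_nonempty with h | h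
      · have h0 : fullRankCodes F L (S.erase v) = Finset.univ := by
          rw [h, Finset.eq_univ_iff_forall]
          exact fun k => mem_fullRankCodes.2 fun i => (L i).fullRank_empty k
        rw [h0]
        refine ⟨?_, Finset.univ_nonempty⟩
        rw [h, Finset.card_empty] at hcard
        rw [← hcard, pow_zero, one_mul, Finset.card_univ]
      · have := ih hS' h hcard
        refine ⟨this.le, Finset.card_pos.1 ?_⟩
        have h0 : (0 : ℝ) < (fullRankCodes F L (S.erase v)).card :=
          lt_of_le_of_lt (by positivity) this
        exact_mod_cast h0
    have hstep := card_fullRankCodes_insert L hS' (Finset.notMem_erase v S) hle.2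
    rw [Finset.insert_erase hvS] at hstep
    calc x ^ (n + 1) * Fintype.card (N.Code w F)
        = x * (x ^ n * Fintype.card (N.Code w F)) := by ring
      _ ≤ x * (fullRankCodes F L (S.erase v)).card := mul_le_mul_of_nonneg_left hle.1 hx
      _ < _ := hstep

end Count

/-! ### From full rank to independent rows, ranks and minimum distance. -/

section Decoding

variable {V E F : Type*} [Fintype V] [DecidableEq V] [Fintype E] [DecidableEq E] [Field F]
  {N : MulticastNetwork V E} {w : ℕ}

/-- The nodes from which channels may start. -/
def nonSinks (N : MulticastNetwork V E) : Finset V := Finset.univ \ N.sinks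

theorem tail_mem_nonSinks (e : E) : N.tail e ∈ N.nonSinks := by
  simp [nonSinks, N.tail_notMem_sinks e]

theorem nonSinks_card : N.nonSinks.card = N.internalNodes.card + 1 := by
  have h : N.nonSinks = insert N.source N.internalNodes := by
    ext v
    by_cases hv : v = N.source
    · subst hv
      simp [nonSinks, N.source_notMem_sinks]
    · simp [nonSinks, internalNodes, hv]
  rw [h, Finset.card_insert_of_notMem]
  simp [internalNodes]

theorem trunc_nonSinks (k : N.Code w F) : trunc N.nonSinks k = k := by
  funext p
  exact if_pos (tail_mem_nonSinks _)

theorem Linking.FullRank.linearIndepOn {t : V} {A : Finset (Fin w ⊕ E)} {L : N.Linking w t A}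
    {k : N.Code w F} (h : L.FullRank N.nonSinks (trunc N.nonSinks k)) :
    LinearIndepOn F (N.decodingRow k t) (A : Set (Fin w ⊕ E)) := by
  rw [trunc_nonSinks] at h
  rw [linearIndepOn_finset_iff]
  intro g hg x hx
  -- All tails are processed, so the frontier lies in In(t), and a relation among the rows in A is a
  -- vector on A orthogonal to it.
  have h0 := h (fun x => if x ∈ A then g x else 0) (fun d hd => if_neg hd) ?_
  · simpa [hx] using congrFun h0 x
  · rintro d ⟨hdL, -, hd⟩
    rcases L.exists_pred_eq d hdL with ⟨e, rfl, he⟩ | ⟨y, hy, hyA, rfl⟩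
    · have := congrFun hg ⟨e, he⟩
      simpa [dotProduct, decodingRow_apply, Finset.sum_ite_mem] using this
    · obtain ⟨e, rfl, -⟩ := L.pred_adj y hy hyA
      exact absurd rfl (hd e hy hyA (tail_mem_nonSinks e))

/-- For a single linking the lower bound is nonnegative and strict, so a code exists over every
finite field, even for q = 2. -/
theorem exists_linearIndepOn_of_linking [Fintype F] {t : V} {A : Finset (Fin w ⊕ E)}
    (L : N.Linking w t A) :
    ∃ k : N.Code w F, LinearIndepOn F (N.decodingRow k t) (A : Set (Fin w ⊕ E)) := by
  have h1 : (2 : ℝ) ≤ Fintype.card F := by exact_mod_cast Fintype.one_lt_card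
  have h := card_fullRankCodes (F := F) (fun _ : Unit => L) (by simp; linarith)
    (S := N.nonSinks) (fun e _ => tail_mem_nonSinks e)
    ⟨N.source, by simp [nonSinks, N.source_notMem_sinks]⟩
  have h2 : (0 : ℝ) < (fullRankCodes F (fun _ : Unit => L) N.nonSinks).card := by
    refine lt_of_le_of_lt (mul_nonneg (pow_nonneg ?_ _) (Nat.cast_nonneg _)) h
    rw [sub_nonneg]
    refine div_le_one_of_le₀ ?_ (by linarith)
    rw [Fintype.card_unit, Nat.cast_one]
    linarith
  obtain ⟨k, hk⟩ := Finset.card_pos.1 (Nat.cast_pos.1 h2)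
  exact ⟨k, (mem_fullRankCodes.1 hk ()).linearIndepOn⟩

/-- One code suffices as certificate: a dominating pattern must span at least |ρ| dimensions for it.
-/
theorem card_le_patternRank {t : V} {ρ : Finset E} {k : N.Code w F}
    (h : LinearIndepOn F (fun e => N.decodingRow k t (Sum.inr e)) (ρ : Set E)) :
    ρ.card ≤ N.patternRank w F t ρ := by
  classical
  obtain ⟨ρ', hρ', hcard⟩ := N.exists_dominated_card_eq_patternRank (w := w) F t ρ
  have h1 := Submodule.finrank_mono (hρ' k)
  rw [errorSpace_eq_span, errorSpace_eq_span] at h1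
  have h2 : Module.finrank F (Submodule.span F
      ((fun e => N.decodingRow k t (Sum.inr e)) '' (ρ : Set E))) = ρ.card := by
    rw [Set.image_eq_range]
    exact (finrank_span_eq_card h).trans (by simp)
  rw [← hcard, ← h2]
  refine h1.trans ?_
  rw [← Finset.coe_image]
  exact (finrank_span_finset_le_card _).trans Finset.card_image_le

theorem patternRank_le_card (F : Type*) [Field F] (t : V) (ρ : Finset E) :
    N.patternRank w F t ρ ≤ ρ.card :=
  Dominated.patternRank_le N (fun _ => le_rfl)

theorem mem_fullRankPatterns {t : V} {ρ : Finset E} {k : N.Code w F}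
    (h : LinearIndepOn F (fun e => N.decodingRow k t (Sum.inr e)) (ρ : Set E))
    (hρ : ρ.card = N.redundancy w t) : ρ ∈ N.fullRankPatterns w F t := by
  have h1 := card_le_patternRank h
  have h2 := N.patternRank_le_card (w := w) F t ρ
  simp only [fullRankPatterns, Finset.mem_filter, Finset.mem_univ, true_and]
  exact ⟨hρ, by omega⟩

theorem minCut_le_card_head {t : V} (ht : t ∈ N.sinks) :
    N.minCut t ≤ Fintype.card {e : E // N.head e = t} := by
  rw [Fintype.card_subtype]
  refine IsCut.minCut_le N fun h => ?_
  rcases Relation.ReflTransGen.cases_tail h with h | ⟨_, -, e, he, -, h⟩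
  · exact N.source_notMem_sinks (h ▸ ht)
  · exact he (by simpa using h)

/-- An error pattern of full rank and of size at most `δ_t` is contained in a pattern of
`R_t(δ_t)`. -/
theorem exists_superset_mem_fullRankPatterns [Fintype F] {t : V} (ht : t ∈ N.sinks)
    {ρ : Finset E} (hρ : N.patternRank w F t ρ = ρ.card) (hle : ρ.card ≤ N.redundancy w t) :
    ∃ ρ' ∈ N.fullRankPatterns w F t, ρ ⊆ ρ' := by
  classical
  obtain ⟨L⟩ := N.exists_linking_errorPattern (w := w) F hρ
  obtain ⟨k, hk⟩ := exists_linearIndepOn_of_linking (F := F) L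
  have hk' : LinearIndepOn F (fun e => N.decodingRow k t (Sum.inr e)) (ρ : Set E) := by
    rw [Finset.coe_map] at hk
    exact hk.comp_of_image Sum.inr_injective.injOn
  -- Extend the rows of ρ to a basis of the row space. It has |In(t)| ≥ C_t ≥ δ_t members, so it can
  -- be trimmed to size δ_t.
  obtain ⟨b, -, hρb, hspan, hb⟩ := exists_linearIndepOn_extension hk' (Set.subset_univ _)
  have htop : Submodule.span F ((fun e => N.decodingRow k t (Sum.inr e)) '' b) = ⊤ := by
    rw [eq_top_iff, ← (Pi.basisFun F {e : E // N.head e = t}).span_eq, Submodule.span_le]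
    rintro _ ⟨e, rfl⟩
    refine hspan ⟨e.1, Set.mem_univ _, ?_⟩
    rw [Pi.basisFun_apply]
    exact N.decodingRow_of_head_eq k ht e
  have hcard : Fintype.card {e : E // N.head e = t} ≤ b.toFinset.card := by
    have h1 : Module.finrank F (Submodule.span F
        ((fun e => N.decodingRow k t (Sum.inr e)) '' b)) ≤ b.toFinset.card := by
      have h2 := (finrank_span_finset_le_card (R := F)
        (b.toFinset.image fun e => N.decodingRow k t (Sum.inr e))).trans Finset.card_image_le
      rwa [Finset.coe_image, Set.coe_toFinset] at h2
    rwa [htop, finrank_top, Module.finrank_fintype_fun_eq_card] at h1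
  obtain ⟨ρ', h1, h2, h3⟩ := Finset.exists_subsuperset_card_eq (s := ρ) (t := b.toFinset)
    (n := N.redundancy w t) (fun e he => by simpa using hρb he) hle
    ((Nat.sub_le _ _).trans ((minCut_le_card_head ht).trans hcard))
  exact ⟨ρ', mem_fullRankPatterns (hb.mono fun e he => by simpa using h2 he) h3, h1⟩

/-- Without a pattern the strict bound would read 0 < 0. The empty pattern is extended. -/
theorem fullRankPatterns_nonempty [Fintype F] {t : V} (ht : t ∈ N.sinks) :
    (N.fullRankPatterns w F t).Nonempty := by
  obtain ⟨ρ, hρ, -⟩ := exists_superset_mem_fullRankPatterns (N := N) (w := w) (F := F) ht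
    (ρ := ∅) (Nat.le_zero.1 (patternRank_le_card F t ∅)) (Nat.zero_le _)
  exact ⟨ρ, hρ⟩

theorem finrank_messageSpace {t : V} {k : N.Code w F} {ρ : Finset E}
    (h : LinearIndepOn F (N.decodingRow k t) (withMessages w ρ : Set (Fin w ⊕ E))) :
    Module.finrank F (N.messageSpace k t) = w := by
  rw [messageSpace_eq_span]
  have hl : LinearIndepOn F (N.decodingRow k t) (Sum.inl '' (Set.univ : Set (Fin w))) :=
    h.mono (by rintro _ ⟨i, -, rfl⟩; simp [withMessages])
  have h0 : LinearIndepOn F (fun i : Fin w => N.decodingRow k t (Sum.inl i)) Set.univ :=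
    hl.comp_of_image Sum.inl_injective.injOn
  have h1 := linearIndepOn_univ_iff.1 h0
  rw [finrank_span_eq_card h1, Fintype.card_fin]

theorem disjoint_errorSpace_messageSpace {t : V} {k : N.Code w F} {ρ : Finset E}
    (h : LinearIndepOn F (N.decodingRow k t) (withMessages w ρ : Set (Fin w ⊕ E))) :
    N.errorSpace k t ρ ⊓ N.messageSpace k t = ⊥ := by
  rw [← disjoint_iff, errorSpace, messageSpace, map_vectorsOn, map_vectorsOn]
  let A : Set (Fin w ⊕ E) := withMessages w ρ
  have h1 := h.linearIndependent.disjoint_span_image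
    (s := {x : A | x.1 ∈ Sum.inr '' (ρ : Set E)}) (t := {x : A | x.1 ∈ Set.range Sum.inl})
    (Set.disjoint_left.2 (by rintro ⟨_, _⟩ ⟨e, _, rfl⟩ ⟨i, hi⟩; cases hi))
  refine h1.mono (Submodule.span_mono ?_) (Submodule.span_mono ?_)
  · rintro _ ⟨_, ⟨e, he, rfl⟩, rfl⟩
    exact ⟨⟨Sum.inr e, by simpa [A, withMessages] using he⟩, ⟨e, he, rfl⟩, rfl⟩
  · rintro _ ⟨_, ⟨i, rfl⟩, rfl⟩
    exact ⟨⟨Sum.inl i, by simp [withMessages]⟩, ⟨i, rfl⟩, rfl⟩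

/-- If decoding is possible for all error patterns of `R_t(δ_t)`, then the code is MDS at `t`. -/
theorem redundancy_lt_minDist [Fintype F] {t : V} (ht : t ∈ N.sinks) {k : N.Code w F}
    (h : ∀ ρ ∈ N.fullRankPatterns w F t,
      LinearIndepOn F (N.decodingRow k t) (withMessages w ρ : Set (Fin w ⊕ E))) :
    ¬ N.minDist k t < ((N.redundancy w t + 1 : ℕ) : ℕ∞) := by
  intro hlt
  simp only [minDist, iInf_lt_iff, Nat.cast_lt] at hlt
  obtain ⟨ρ, hpos, hrank⟩ := hlt
  -- A smallest pattern ρ₁ dominating ρ has rank |ρ₁|: a smaller ρ₂ dominating it would dominate ρ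
  -- too.
  obtain ⟨ρ₁, hdom, hcard⟩ := N.exists_dominated_card_eq_patternRank (w := w) F t ρ
  obtain ⟨ρ₂, hdom₂, hcard₂⟩ := N.exists_dominated_card_eq_patternRank (w := w) F t ρ₁
  have h1 : N.patternRank w F t ρ ≤ ρ₂.card :=
    Dominated.patternRank_le N fun k => (hdom k).trans (hdom₂ k)
  have h2 := N.patternRank_le_card (w := w) F t ρ₁
  obtain ⟨ρ', hρ', hsub⟩ := exists_superset_mem_fullRankPatterns ht (ρ := ρ₁)
    (show N.patternRank w F t ρ₁ = ρ₁.card by omega) (by omega)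
  have h3 : N.errorSpace k t ρ ⊓ N.messageSpace k t = ⊥ := by
    rw [eq_bot_iff, ← disjoint_errorSpace_messageSpace (h ρ' hρ')]
    exact inf_le_inf_right _ ((hdom k).trans (N.errorSpace_mono k t hsub))
  rw [h3, finrank_bot] at hpos
  exact absurd hpos (lt_irrefl 0)

end Decoding

/-! ### From counting codes to probabilities. -/

section Probability

variable {V E F : Type*} [Fintype V] [DecidableEq V] [Fintype E] [DecidableEq E]
  [Field F] [Fintype F] [MeasurableSpace F] [MeasurableSingletonClass F]
  {N : MulticastNetwork V E} {w : ℕ}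

instance : IsProbabilityMeasure (uniformOn (Set.univ : Set F)) :=
  isProbabilityMeasure_uniformOn Set.finite_univ Set.univ_nonempty

instance : IsProbabilityMeasure (N.randomCode w F) := by
  unfold randomCode; infer_instance

theorem randomCode_real_singleton (k : N.Code w F) :
    (N.randomCode w F).real {k} = (Fintype.card (N.Code w F) : ℝ)⁻¹ := by
  have h : ∀ x : F, uniformOn (Set.univ : Set F) {x} = (Fintype.card F : ENNReal)⁻¹ := by
    intro x
    rw [uniformOn_univ, Measure.count_singleton, one_div]
  rw [measureReal_def, randomCode, Measure.pi_singleton, Finset.prod_congr rfl fun i _ => h _,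
    Finset.prod_const, Finset.card_univ, Fintype.card_fun]
  simp

theorem randomCode_real_coe (s : Finset (N.Code w F)) :
    (N.randomCode w F).real s = s.card / (Fintype.card (N.Code w F) : ℝ) := by
  rw [← sum_measureReal_singleton, Finset.sum_congr rfl fun k _ => randomCode_real_singleton k,
    Finset.sum_const, nsmul_eq_mul, div_eq_mul_inv]

/-- The probability that a code fails, if it does not fail as soon as all linkings of a family have
full rank. -/
theorem randomCode_real_lt {ι : Type*} [Fintype ι] [Nonempty ι] {t : ι → V}
    {A : ι → Finset (Fin w ⊕ E)} (L : ∀ i, N.Linking w (t i) (A i))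
    (hι : (Fintype.card ι : ℝ) ≤ (Fintype.card F : ℝ) - 1 ∨ Even N.internalNodes.card)
    (s : Set (N.Code w F)) (hs : ∀ k ∈ s, k ∉ fullRankCodes F L N.nonSinks) :
    (N.randomCode w F).real s <
      1 - (1 - (Fintype.card ι : ℝ) / ((Fintype.card F : ℝ) - 1)) ^
        (N.internalNodes.card + 1) := by
  by_cases hle : (Fintype.card ι : ℝ) ≤ (Fintype.card F : ℝ) - 1
  · have h := card_fullRankCodes L hle (S := N.nonSinks) (fun e _ => tail_mem_nonSinks e)
      ⟨N.source, by simp [nonSinks, N.source_notMem_sinks]⟩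
    have hC : (0 : ℝ) < Fintype.card (N.Code w F) := by exact_mod_cast Fintype.card_pos
    rw [nonSinks_card, ← lt_div_iff₀ hC, ← randomCode_real_coe] at h
    have h1 : (N.randomCode w F).real s ≤
        (N.randomCode w F).real ((fullRankCodes F L N.nonSinks : Set (N.Code w F))ᶜ) :=
      measureReal_mono fun k hk => by simpa using hs k hk
    rw [probReal_compl_eq_one_sub (Set.toFinite _).measurableSet] at h1
    linarith
  -- The base is negative and the exponent odd, so the bound exceeds 1.
  · have hodd : Odd (N.internalNodes.card + 1) := (hι.resolve_left hle).add_one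
    have hq : (0 : ℝ) < (Fintype.card F : ℝ) - 1 := by
      have : (1 : ℝ) < Fintype.card F := by exact_mod_cast Fintype.one_lt_card
      linarith
    have hneg : 1 - (Fintype.card ι : ℝ) / ((Fintype.card F : ℝ) - 1) < 0 := by
      rw [sub_neg, one_lt_div hq]
      exact not_le.1 hle
    have := hodd.pow_neg hneg
    have := measureReal_le_one (μ := N.randomCode w F) (s := s)
    linarith

end Probability

end MulticastNetwork

theorem mainTheorem4 {V E F : Type*} [Fintype V] [DecidableEq V] [Fintype E] [DecidableEq E]
    [Field F] [Fintype F] [MeasurableSpace F] [MeasurableSingletonClass F]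
    (N : MulticastNetwork V E) (w : ℕ) (hw : ∀ t ∈ N.sinks, w ≤ N.minCut t) :
    (∀ t ∈ N.sinks,
      (((N.fullRankPatterns w F t).card : ℝ) ≤ (Fintype.card F : ℝ) - 1 ∨
        Even N.internalNodes.card) →
      N.failureProbAt w F t <
        1 - (1 - ((N.fullRankPatterns w F t).card : ℝ) / ((Fintype.card F : ℝ) - 1)) ^
          (N.internalNodes.card + 1)) ∧
    (N.sinks.Nonempty →
      (∑ t ∈ N.sinks, ((N.fullRankPatterns w F t).card : ℝ) ≤ (Fintype.card F : ℝ) - 1 ∨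
        Even N.internalNodes.card) →
      N.failureProb w F <
        1 - (1 - (∑ t ∈ N.sinks, ((N.fullRankPatterns w F t).card : ℝ)) /
          ((Fintype.card F : ℝ) - 1)) ^ (N.internalNodes.card + 1)) := by
  have link : ∀ t ∈ N.sinks, ∀ ρ ∈ N.fullRankPatterns w F t,
      Nonempty (N.Linking w t (MulticastNetwork.withMessages w ρ)) := fun t ht ρ hρ =>
    N.exists_linking_withMessages F ht (hw t ht) hρ
  refine ⟨fun t ht hcard => ?_, fun hT hcard => ?_⟩
  · let L : ∀ ρ : N.fullRankPatterns w F t, N.Linking w t (MulticastNetwork.withMessages w ρ.1) :=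
      fun ρ => (link t ht ρ.1 ρ.2).some
    have : Nonempty (N.fullRankPatterns w F t) :=
      (MulticastNetwork.fullRankPatterns_nonempty ht).to_subtype
    have h := MulticastNetwork.randomCode_real_lt (F := F) L (by simpa using hcard)
      {k | Module.finrank F (N.messageSpace k t) < w ∨
        N.minDist k t < ((N.redundancy w t + 1 : ℕ) : ℕ∞)} ?_
    · rw [Fintype.card_coe] at h
      exact h
    · intro k hk hL
      have hli := fun ρ hρ => (MulticastNetwork.mem_fullRankCodes.1 hL ⟨ρ, hρ⟩).linearIndepOn
      rcases hk with hk | hk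
      · obtain ⟨ρ, hρ⟩ := this
        exact hk.ne (MulticastNetwork.finrank_messageSpace (hli ρ hρ))
      · exact MulticastNetwork.redundancy_lt_minDist ht hli hk
  -- All sinks are treated at once: the union bound runs over pairs (t, ρ).
  · let ι := Σ t : N.sinks, N.fullRankPatterns w F t.1
    let L : ∀ i : ι, N.Linking w i.1.1 (MulticastNetwork.withMessages w i.2.1) :=
      fun i => (link i.1.1 i.1.2 i.2.1 i.2.2).some
    have hι : (Fintype.card ι : ℝ) = ∑ t ∈ N.sinks, ((N.fullRankPatterns w F t).card : ℝ) := by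
      rw [Fintype.card_sigma, Nat.cast_sum,
        ← Finset.sum_coe_sort N.sinks fun t => ((N.fullRankPatterns w F t).card : ℝ)]
      simp
    have hne : ∀ t ∈ N.sinks, (N.fullRankPatterns w F t).Nonempty := fun t ht =>
      MulticastNetwork.fullRankPatterns_nonempty ht
    have : Nonempty ι := by
      obtain ⟨t, ht⟩ := hT
      obtain ⟨ρ, hρ⟩ := hne t ht
      exact ⟨⟨⟨t, ht⟩, ⟨ρ, hρ⟩⟩⟩
    rw [← hι] at hcard ⊢
    refine MulticastNetwork.randomCode_real_lt (F := F) L hcard _ ?_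
    intro k hk hL
    have hli := fun t ht ρ hρ =>
      (MulticastNetwork.mem_fullRankCodes.1 hL ⟨⟨t, ht⟩, ⟨ρ, hρ⟩⟩).linearIndepOn
    rcases hk with hk | ⟨t, ht, hk⟩
    · refine hk fun t ht => ?_
      obtain ⟨ρ, hρ⟩ := hne t ht
      exact MulticastNetwork.finrank_messageSpace (hli t ht ρ hρ)
    · exact MulticastNetwork.redundancy_lt_minDist ht (hli t ht) hk
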